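/- Let $n\ge 2$ be an integer and put $\alpha=2^n+1$, $m=(\alpha+1)^2(\alpha-1)$ and $r=\alpha^2-1$. A subset $D$ of a finite group $G$ is a $(v,k,\lambda,\mu)$ partial difference set if $|G|=v$, $|D|=k$, and the expressions $gh^{-1}$ with $g,h\in D$, $g\neq h$, represent each non-identity element of $D$ exactly $\lambda$ times and each non-identity element of $G\setminus D$ exactly $\mu$ times. A proper partial geometry $\mathrm{pg}(s,t,\alpha)$ is a finite point-line geometry with at least one point in which every line contains exactly $s+1$ points, every point lies on exactly $t+1$ lines, two distinct lines meet in at most one point, and, for every point $x$ and every line $L$ not containing $x$, exactly $\alpha$ lines through $x$ intersect $L$, where $0<\alpha<\min(s,t)$. An abelian Singer group of such a geometry is an abelian group $G$ of automorphisms acting sharply transitively on its points; the geometry is of rigid type with respect to $G$ if every line has trivial stabilizer in $G$. Then: 1. No abelian group contains an $\bigl(m^2,\ r(m+1),\ -m+r^2+3r,\ r^2+r\bigr)$ partial difference set. 2. There is no proper partial geometry $\mathrm{pg}(\alpha^2+\alpha-1,\ \alpha^3-\alpha-1,\ \alpha)$ admitting an abelian Singer group with respect to which it is of rigid type. -/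

import Mathlib

/-- `D` is a `(v, k, l, μ)`-partial difference set in the finite group `G`: `G` has order `v`,
`D` has size `k`, and the expressions `g * h⁻¹` with `g, h ∈ D`, `g ≠ h`, represent every
non-identity element of `D` exactly `l` times and every non-identity element of `G` outside `D`
exactly `μ` times. The parameters are integers, so that no subtraction is truncated. The set `D`
is not assumed to be closed under inverses or to avoid the identity. -/
structure IsPartialDifferenceSet {G : Type*} [Group G] (D : Set G) (v k l μ : ℤ) : Prop where
  finite : Finite G
  card_group : (Nat.card G : ℤ) = v
  card_set : (D.ncard : ℤ) = k
  rep_mem : ∀ x ∈ D, x ≠ 1 →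
    (({p : G × G | p.1 ∈ D ∧ p.2 ∈ D ∧ p.1 ≠ p.2 ∧ p.1 * p.2⁻¹ = x}.ncard : ℕ) : ℤ) = l
  rep_not_mem : ∀ x ∉ D, x ≠ 1 →
    (({p : G × G | p.1 ∈ D ∧ p.2 ∈ D ∧ p.1 ≠ p.2 ∧ p.1 * p.2⁻¹ = x}.ncard : ℕ) : ℤ) = μ

/-- The incidence relation `Inc` between the points `P` and the lines `L` is a proper partial
geometry `pg(s, t, α)`. -/
structure IsProperPartialGeometry {P L : Type*} (Inc : P → L → Prop) (s t α : ℤ) : Prop where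
  finite_points : Finite P
  finite_lines : Finite L
  nonempty_points : Nonempty P
  pos : 0 < α
  proper : α < min s t
  /-- every line contains `s + 1` points -/
  card_points : ∀ l : L, ({x : P | Inc x l}.ncard : ℤ) = s + 1
  /-- every point is contained in `t + 1` lines -/
  card_lines : ∀ x : P, ({l : L | Inc x l}.ncard : ℤ) = t + 1
  /-- two distinct lines intersect in at most one point -/
  inter : ∀ l l' : L, l ≠ l' → {x : P | Inc x l ∧ Inc x l'}.Subsingleton
  /-- if `x` is not on `l`, exactly `α` lines through `x` intersect `l` -/
  card_meet : ∀ (x : P) (l : L), ¬ Inc x l →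
    ({l' : L | Inc x l' ∧ ∃ y : P, Inc y l' ∧ Inc y l}.ncard : ℤ) = α

/-- The group `G`, acting on the points and on the lines of a point-line geometry, acts as a
Singer group: it acts by automorphisms, and sharply transitively on the points. -/
structure IsSingerGroup (G : Type*) [Group G] {P L : Type*} [MulAction G P] [MulAction G L]
    (Inc : P → L → Prop) : Prop where
  inc_smul_iff : ∀ (g : G) (x : P) (l : L), Inc (g • x) (g • l) ↔ Inc x l
  sharply_transitive : ∀ x y : P, ∃! g : G, g • x = y

/-- Rigid type: every line has a trivial stabilizer in `G`. -/
def IsRigidType (G : Type*) [Group G] (L : Type*) [MulAction G L] : Prop :=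
  ∀ l : L, MulAction.stabilizer G l = ⊥

/-! Put `u = 2 ^ (n - 1) + 1`, so that `α = 2u - 1`, `r = 4(u - 1)u`, `m = 8(u - 1)u²` and `|G| =
64(u - 1)² u⁴`, a power of 2 times the odd number `u⁴`. Factor out the subgroup `H` of order `u⁴`
and let `B` be the image of `D` in `ℤ[Q]`, `Q = G ⧸ H`. Completing the square in the group ring
equation of `D` gives `F = 2B - (2r - m) - u³T`, `T` the sum of `Q`, with `F² = m² = u⁴|Q|`. As `u`
is prime to `|Q|`, `F = u²E` with `E² = |Q|` (`exists_eq_smul_of_mul_self_eq`). The coefficients of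
`F` are odd, so those of `E` are nonzero; their squares sum to `|Q|`, so all are `±1`. At the
identity this makes `|D ∩ H|` negative. For the geometry, a Singer group turns collinearity into a
partial difference set with these parameters. -/

/-! ### Square roots of integers in group rings -/

-- The `p`-th power map on the group algebra is induced by `s ↦ s ^ p` on `S`, which is injective
-- when `p` is prime to `|S|`; so there are no nilpotents.
open MonoidAlgebra in
theorem MonoidAlgebra.eq_zero_of_sq_eq_zero {S : Type*} [CommGroup S] {p : ℕ}
    [Fact p.Prime] (hp : (Nat.card S).Coprime p) {x : MonoidAlgebra (ZMod p) S} (hx : x * x = 0) :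
    x = 0 := by
  have hpow : x ^ p = mapDomain (fun s : S => s ^ p) x := by
    clear hx
    have : CharP (MonoidAlgebra (ZMod p) S) p :=
      charP_of_injective_ringHom (f := singleOneRingHom (R := ZMod p) (M := S))
        (fun a b h => by simpa [singleOneRingHom] using h) p
    induction x using MonoidAlgebra.induction_linear with
    | zero => simp [(Fact.out : p.Prime).ne_zero]
    | add a b ha hb => rw [add_pow_char, ha, hb, mapDomain_add]
    | single s a => simp [single_pow, mapDomain_single]
  have h0 : x ^ p = 0 := by
    rw [← pow_mul_pow_sub x (Fact.out : p.Prime).two_le, pow_two, hx, zero_mul]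
  have hinj : Function.Injective (fun s : S => s ^ p) := (powCoprime hp).injective
  apply mapDomain_injective hinj
  rw [← hpow, h0, mapDomain_zero]

-- Split off one prime `p` of `w` at a time: modulo `p` the square of `F` vanishes, hence so does
-- `F`.
open MonoidAlgebra in
theorem MonoidAlgebra.exists_eq_smul_of_mul_self_eq {S : Type*} [CommGroup S] (w : ℕ) (hw : w ≠ 0)
    (hS : (Nat.card S).Coprime w) (N : ℤ) (F : MonoidAlgebra ℤ S)
    (hF : F * F = single 1 ((w : ℤ) ^ 2 * N)) :
    ∃ E : MonoidAlgebra ℤ S, F = (w : ℤ) • E ∧ E * E = single 1 N := by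
  induction w using induction_on_primes generalizing F with
  | zero => exact absurd rfl hw
  | one => exact ⟨F, by simp, by simpa using hF⟩
  | prime_mul p w hp ih =>
    have : Fact p.Prime := ⟨hp⟩
    have hp0 : (p : ℤ) ≠ 0 := by exact_mod_cast hp.ne_zero
    have h0 : map ((Int.castRingHom (ZMod p)) : ℤ →+ ZMod p) F = 0 := by
      apply eq_zero_of_sq_eq_zero (p := p) (Nat.Coprime.coprime_mul_right_right hS)
      have := MonoidAlgebra.map_mul (Int.castRingHom (ZMod p)) F F
      erw [← this]
      rw [hF, map_single]
      simp
    have hdvd : ∀ s, (p : ℤ) ∣ F.coeff s := fun s => by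
      rw [← ZMod.intCast_zmod_eq_zero_iff_dvd]
      have := congrArg (fun y => y.coeff s) h0
      simpa using this
    obtain ⟨F', rfl⟩ : ∃ F', F = (p : ℤ) • F' := by
      refine ⟨ofCoeff (F.coeff.mapRange (fun a => a / (p : ℤ)) (by simp)), ?_⟩
      ext s
      rw [coeff_smul_apply]
      simp [Int.mul_ediv_cancel' (hdvd s)]
    classical
    obtain ⟨E, rfl, hE⟩ := ih (by rintro rfl; simp at hw)
      (Nat.Coprime.coprime_mul_left_right hS) F' (by
        have h := hF
        rw [smul_mul_smul_comm] at h
        ext s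
        have := congrArg (fun y => y.coeff s) h
        simp only [coeff_smul_apply, coeff_single, Finsupp.single_apply, smul_eq_mul] at this ⊢
        apply mul_left_cancel₀ (mul_ne_zero hp0 hp0)
        rw [this]
        split_ifs <;> push_cast <;> ring)
    exact ⟨E, by rw [smul_smul, Nat.cast_mul], hE⟩

open MonoidAlgebra in
theorem MonoidAlgebra.coeff_sq_eq_one_of_mul_self_eq_card {S : Type*} [CommGroup S] [Fintype S]
    (E : MonoidAlgebra ℤ S) (hE : E * E = single 1 (Fintype.card S : ℤ))
    (hsymm : ∀ s, E.coeff s⁻¹ = E.coeff s) (hne : ∀ s, E.coeff s ≠ 0) (s : S) :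
    E.coeff s ^ 2 = 1 := by
  -- By symmetry, the identity coefficient of `E * E` is the sum of squares.
  have h1 : ∑ t, E.coeff t ^ 2 = ∑ t : S, (1 : ℤ) := by
    have := congrArg (fun y => y.coeff 1) hE
    simp only [coeff_mul_apply_left] at this
    rw [Finsupp.sum_fintype _ _ (by simp)] at this
    simpa [hsymm, pow_two] using this
  have hle : ∀ t ∈ Finset.univ, (1 : ℤ) ≤ E.coeff t ^ 2 := fun t _ => by
    have := hne t
    have : 0 < E.coeff t ^ 2 := by positivity
    omega
  exact ((Finset.sum_eq_sum_iff_of_le hle).1 h1.symm s (Finset.mem_univ s)).symm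
-- Counting quotients in `D` and the group ring equation
theorem Finset.card_filter_mul_inv_eq_one {G : Type*} [Group G] [DecidableEq G] (D : Finset G) :
    ((D ×ˢ D).filter (fun p => p.1 * p.2⁻¹ = 1)).card = D.card := by
  refine Finset.card_nbij' (fun p => p.1) (fun g => (g, g)) ?_ ?_ ?_ ?_
  · intro p hp; simp at hp ⊢; exact hp.1.1
  · intro p hp; simpa using hp
  · rintro ⟨a, b⟩ hp
    simp [mul_inv_eq_one] at hp ⊢
    exact hp.2
  · intro p hp; rfl

theorem Finset.card_filter_mul_inv_eq_inv {G : Type*} [Group G] [DecidableEq G] (D : Finset G)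
    (x : G) : ((D ×ˢ D).filter (fun p => p.1 * p.2⁻¹ = x⁻¹)).card =
      ((D ×ˢ D).filter (fun p => p.1 * p.2⁻¹ = x)).card := by
  refine Finset.card_nbij' Prod.swap Prod.swap ?_ ?_ ?_ ?_
  · rintro ⟨a, b⟩ hp
    simp at hp ⊢
    exact ⟨hp.1.symm, by rw [← inv_inj, ← hp.2]; group⟩
  · rintro ⟨a, b⟩ hp
    simp at hp ⊢
    exact ⟨hp.1.symm, by rw [← hp.2]; group⟩
  · intro p _; simp
  · intro p _; simp

theorem Finset.sum_card_filter_mul_inv_eq {G : Type*} [Group G] [Fintype G] [DecidableEq G]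
    (D : Finset G) :
    ∑ x, ((D ×ˢ D).filter (fun p => p.1 * p.2⁻¹ = x)).card = D.card ^ 2 := by
  rw [← Finset.card_eq_sum_card_fiberwise (by simp), Finset.card_product, pow_two]

open MonoidAlgebra in
/-- The group ring equation of a partial difference set in an abelian group. -/
theorem groupRing_mul_self_of_card_rep {G : Type*} [CommGroup G] [Fintype G] [DecidableEq G]
    {D : Finset G} {k l μ : ℤ} (hk : (D.card : ℤ) = k)
    (hrep : ∀ x ≠ 1, (((D ×ˢ D).filter (fun p => p.1 * p.2⁻¹ = x)).card : ℤ)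
      = if x ∈ D then l else μ)
    (hlμ : l ≠ μ) (hcount : k ^ 2 = k + l * k + μ * (Fintype.card G - 1 - k)) :
    (∀ x, x⁻¹ ∈ D ↔ x ∈ D) ∧
      (∑ g ∈ D, of ℤ G g) * (∑ g ∈ D, of ℤ G g) = ((k - μ : ℤ) : MonoidAlgebra ℤ G)
        + ((l - μ : ℤ) : MonoidAlgebra ℤ G) * (∑ g ∈ D, of ℤ G g)
        + (μ : MonoidAlgebra ℤ G) * ∑ g : G, of ℤ G g := by
  set N : G → ℤ := fun x => (((D ×ˢ D).filter (fun p => p.1 * p.2⁻¹ = x)).card : ℤ) with hN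
  have hN1 : N 1 = k := by rw [← hk, ← D.card_filter_mul_inv_eq_one]
  have hNinv : ∀ x, N x⁻¹ = N x := fun x =>
    congrArg (Nat.cast : ℕ → ℤ) (D.card_filter_mul_inv_eq_inv x)
  -- `x` and `x⁻¹` have equally many representations, and `l ≠ μ` lets this number detect membership
  -- in `D`.
  have hinv : ∀ x, x⁻¹ ∈ D ↔ x ∈ D := by
    intro x
    by_cases hx : x = 1
    · simp [hx]
    have h1 := hrep x hx
    have h2 := hrep x⁻¹ (by simpa using hx)
    have h3 := hNinv x
    simp only [hN] at h3
    rw [h1, h2] at h3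
    split_ifs at h3 with h4 h5 h6 <;> simp_all
  have hsum : ∑ x, N x = k ^ 2 := by
    rw [← hk]
    simp only [hN]
    exact_mod_cast D.sum_card_filter_mul_inv_eq
  have hNx : ∀ x, N x = μ + (if x ∈ D then l - μ else 0)
      + (if x = 1 then (k - μ - if (1 : G) ∈ D then l - μ else 0) else 0) := by
    intro x
    by_cases hx : x = 1
    · subst hx; rw [hN1, if_pos rfl]; ring
    · have := hrep x hx
      simp only [hN, this, if_neg hx]
      split_ifs <;> ring
  -- If `1 ∈ D`, only `k - 1` non-identity elements have `l` representations; comparing with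
  -- `hcount` forces `l = μ`.
  have h1 : (1 : G) ∉ D := by
    intro h1
    simp only [hNx, h1, if_true] at hsum
    rw [Finset.sum_add_distrib, Finset.sum_add_distrib, Finset.sum_ite_mem] at hsum
    simp [hk] at hsum
    apply hlμ
    linear_combination -hsum - hcount
  refine ⟨hinv, ?_⟩
  have hA : ∑ g ∈ D, of ℤ G g = ∑ g ∈ D, of ℤ G g⁻¹ :=
    Finset.sum_nbij' (fun g => g⁻¹) (fun g => g⁻¹) (fun g hg => (hinv g).2 hg)
      (fun g hg => (hinv g).2 hg) (by simp) (by simp) (by simp)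
  have hprod : (∑ g ∈ D, of ℤ G g) * (∑ g ∈ D, of ℤ G g) = ∑ x, N x • of ℤ G x := by
    conv_lhs => arg 2; rw [hA]
    rw [Finset.sum_mul_sum, ← Finset.sum_product',
      ← Finset.sum_fiberwise _ (fun p : G × G => p.1 * p.2⁻¹)]
    refine Finset.sum_congr rfl fun x _ => ?_
    rw [Finset.sum_congr rfl (g := fun _ => of ℤ G x), Finset.sum_const]
    · simp [hN]
    · intro p hp
      rw [← map_mul, (Finset.mem_filter.1 hp).2]
  rw [hprod]
  simp only [hNx, h1, if_false, sub_zero, add_smul, Finset.sum_add_distrib, ite_smul, zero_smul,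
    Finset.sum_ite_mem, Finset.univ_inter, Finset.sum_ite_eq', Finset.mem_univ, if_true,
    ← Finset.smul_sum, map_one]
  simp only [zsmul_eq_mul, mul_one]
  ring

/-! ### Nonexistence of the partial difference sets -/

open MonoidAlgebra in
/-- A partial difference set of negative Latin square type with `λ - μ = 2 r - m`, where
`r = 4 (u - 1) u` and `m = 8 (u - 1) u²`, cannot exist when `G` has a quotient of order coprime
to `u` by a subgroup of order `u ^ 4`. -/
theorem not_exists_groupRing_of_quotient {G Q : Type*} [CommGroup G] [Fintype G] [DecidableEq G]
    [CommGroup Q] [Fintype Q] [DecidableEq Q] (π : G →* Q) (hπ : Function.Surjective π) (u : ℕ)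
    (hu : 3 ≤ u) (hodd : Odd u)
    (hQ : (Fintype.card Q : ℤ) = 64 * (u - 1) ^ 2) (hcop : (Fintype.card Q).Coprime u)
    (hG : Fintype.card G = Fintype.card Q * u ^ 4)
    {D : Finset G} {m r : ℤ} (hr : r = 4 * (u - 1) * u) (hm : m = 8 * (u - 1) * u ^ 2)
    (hk : (D.card : ℤ) = r * (m + 1)) (hinv : ∀ x, x⁻¹ ∈ D ↔ x ∈ D)
    (hD : (∑ g ∈ D, of ℤ G g) * (∑ g ∈ D, of ℤ G g) =
      ((r * (m + 1) - (r ^ 2 + r) : ℤ) : MonoidAlgebra ℤ G)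
        + ((2 * r - m : ℤ) : MonoidAlgebra ℤ G) * (∑ g ∈ D, of ℤ G g)
        + ((r ^ 2 + r : ℤ) : MonoidAlgebra ℤ G) * ∑ g : G, of ℤ G g) : False := by
  set T : MonoidAlgebra ℤ Q := ∑ q : Q, of ℤ Q q with hT
  set B : MonoidAlgebra ℤ Q := ∑ g ∈ D, of ℤ Q (π g) with hB
  have hfib : ∀ q : Q, (Finset.univ.filter (fun g => π g = q)).card = u ^ 4 := by
    have hconst : ∀ q q' : Q, (Finset.univ.filter (fun g => π g = q)).card =
        (Finset.univ.filter (fun g => π g = q')).card := fun q q' =>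
      MonoidHom.card_fiber_eq_of_mem_range π (hπ q) (hπ q')
    intro q
    have := Finset.card_eq_sum_card_fiberwise (s := (Finset.univ : Finset G))
      (t := (Finset.univ : Finset Q)) (f := π) (by simp)
    rw [Finset.sum_congr rfl (fun q' _ => hconst q' q), Finset.sum_const, Finset.card_univ, hG,
      smul_eq_mul, Finset.card_univ] at this
    exact (Nat.eq_of_mul_eq_mul_left Fintype.card_pos this).symm
  have hTmul : ∀ q : Q, of ℤ Q q * T = T := by
    intro q
    rw [hT, Finset.mul_sum]
    simp only [← map_mul]
    exact Equiv.sum_comp (Equiv.mulLeft q) (fun x => of ℤ Q x)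
  have hBT : B * T = ((r * (m + 1) : ℤ) : MonoidAlgebra ℤ Q) * T := by
    rw [← hk, hB, Finset.sum_mul, Finset.sum_congr rfl (fun g _ => hTmul (π g))]
    simp
  have hTT : T * T = ((64 * (u - 1) ^ 2 : ℤ) : MonoidAlgebra ℤ Q) * T := by
    rw [← hQ]
    conv_lhs => arg 1; rw [hT]
    rw [Finset.sum_mul, Finset.sum_congr rfl (fun g _ => hTmul g)]
    simp [Finset.card_univ]
  have hBB : B * B = ((r * (m + 1) - (r ^ 2 + r) : ℤ) : MonoidAlgebra ℤ Q)
        + ((2 * r - m : ℤ) : MonoidAlgebra ℤ Q) * B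
        + ((r ^ 2 + r : ℤ) : MonoidAlgebra ℤ Q) * (((u ^ 4 : ℤ) : MonoidAlgebra ℤ Q) * T) := by
    have h := congrArg (mapDomainRingHom ℤ π) hD
    have hof : ∀ g, mapDomainRingHom ℤ π (of ℤ G g) = of ℤ Q (π g) := by
      intro g; simp
    have hmT : mapDomainRingHom ℤ π (∑ g, of ℤ G g) = ((u ^ 4 : ℤ) : MonoidAlgebra ℤ Q) * T := by
      simp only [map_sum, hof]
      rw [← Finset.sum_fiberwise _ π, hT, Finset.mul_sum]
      refine Finset.sum_congr rfl fun q _ => ?_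
      rw [Finset.sum_congr rfl (g := fun _ => of ℤ Q q), Finset.sum_const, hfib, nsmul_eq_mul]
      · push_cast; rfl
      · intro g hg
        rw [(Finset.mem_filter.1 hg).2]
    have hmB : mapDomainRingHom ℤ π (∑ g ∈ D, of ℤ G g) = B := by
      simp only [map_sum, hof, hB]
    rw [map_mul, map_add, map_add, map_mul, map_mul, map_intCast, map_intCast, map_intCast, hmT,
      hmB] at h
    exact h
  -- The coefficient `u³` is chosen so that all multiples of `T` cancel in `F * F`.
  set F : MonoidAlgebra ℤ Q := (2 : ℤ) • B - (2 * r - m) • (1 : MonoidAlgebra ℤ Q)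
    - ((u : ℤ) ^ 3) • T with hF
  have hFF : F * F = single 1 (((u ^ 2 : ℕ) : ℤ) ^ 2 * (Fintype.card Q : ℤ)) := by
    have h1 : (single 1 (((u ^ 2 : ℕ) : ℤ) ^ 2 * (Fintype.card Q : ℤ)) : MonoidAlgebra ℤ Q)
        = ((m ^ 2 : ℤ) : MonoidAlgebra ℤ Q) := by
      rw [intCast_def, hQ, hm]
      congr 1
      push_cast
      ring
    rw [h1, hF]
    simp only [zsmul_eq_mul]
    subst hm hr
    push_cast at hBB hBT hTT ⊢
    linear_combination 4 * hBB - 4 * (u : MonoidAlgebra ℤ Q) ^ 3 * hBT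
      + (u : MonoidAlgebra ℤ Q) ^ 6 * hTT
  obtain ⟨E, hFE, hEE⟩ := exists_eq_smul_of_mul_self_eq (u ^ 2) (by positivity)
    (by rw [Nat.card_eq_fintype_card]; exact hcop.pow_right 2) _ F hFF
  have hTc : ∀ q, T.coeff q = 1 := by
    intro q
    simp [hT, of_apply, coeff_sum, Finsupp.single_apply]
  have hBc : ∀ q, B.coeff q = ((D.filter (fun g => π g = q)).card : ℤ) := by
    intro q
    simp [hB, of_apply, coeff_sum, Finsupp.single_apply]
  have hFc : ∀ q, ((u : ℤ) ^ 2) * E.coeff q = 2 * ((D.filter (fun g => π g = q)).card : ℤ)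
      - (if q = 1 then (2 * r - m) else 0) - u ^ 3 := by
    intro q
    have h := congrArg (fun y => y.coeff q) (hFE.symm.trans hF)
    simp only [coeff_sub, Finsupp.sub_apply, coeff_smul_apply, hBc, hTc, one_def, coeff_single,
      Finsupp.single_apply] at h
    simp only [smul_eq_mul, eq_comm (a := (1 : Q))] at h
    push_cast at h
    rw [h]
    split_ifs <;> ring
  have hsymm : ∀ q, E.coeff q⁻¹ = E.coeff q := by
    intro q
    have h : (D.filter (fun g => π g = q⁻¹)).card = (D.filter (fun g => π g = q)).card := by
      refine Finset.card_nbij' (fun g => g⁻¹) (fun g => g⁻¹) ?_ ?_ ?_ ?_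
      · intro g hg; simp_all
      · intro g hg; simp_all
      · intro g _; simp
      · intro g _; simp
    have h1 := hFc q
    have h2 := hFc q⁻¹
    rw [h] at h2
    simp only [inv_eq_one] at h2
    exact mul_left_cancel₀ (by positivity : ((u : ℤ) ^ 2) ≠ 0) (h2.trans h1.symm)
  -- Parity: `2r - m` is even and `u³` is odd.
  have hne : ∀ q, E.coeff q ≠ 0 := by
    intro q h0
    have h1 := hFc q
    rw [h0, hr, hm] at h1
    have h2 : Odd ((u : ℤ) ^ 3) := by exact_mod_cast hodd.pow
    obtain ⟨j, hj⟩ := h2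
    rw [hj] at h1
    split_ifs at h1
    · have : (8 * ((u : ℤ) - 1) * u ^ 2) = 2 * (4 * (u - 1) * u ^ 2) := by ring
      rw [this] at h1
      omega
    · omega
  have hE1 := coeff_sq_eq_one_of_mul_self_eq_card E hEE hsymm hne 1
  have h1 := hFc 1
  rw [if_pos rfl, hr, hm] at h1
  have hcard : (0 : ℤ) ≤ ((D.filter (fun g => π g = 1)).card : ℤ) := by positivity
  have hEle : E.coeff 1 ≤ 1 := by nlinarith
  have hu' : (3 : ℤ) ≤ u := by exact_mod_cast hu
  -- With `E.coeff 1 ≤ 1`, twice the number of elements of `D` in the kernel is at most `-u(7u² -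
  -- 17u + 8)`, negative for `u ≥ 3`.
  nlinarith [mul_nonneg (sub_nonneg.2 hEle) (sq_nonneg (u : ℤ)), mul_nonneg (sub_nonneg.2 hu') (sub_nonneg.2 hu'), mul_nonneg (mul_nonneg (sub_nonneg.2 hu') (sub_nonneg.2 hu')) (sub_nonneg.2 hu')]
theorem not_partialDifferenceSet_of_card {G : Type*} [CommGroup G] [Fintype G] [DecidableEq G]
    {n : ℕ} (hn : 2 ≤ n) {α m r : ℤ} (hα : α = 2 ^ n + 1) (hm : m = (α + 1) ^ 2 * (α - 1))
    (hr : r = α ^ 2 - 1) (D : Finset G) (hG : (Fintype.card G : ℤ) = m ^ 2)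
    (hk : (D.card : ℤ) = r * (m + 1))
    (hrep : ∀ x ≠ 1, (((D ×ˢ D).filter (fun p => p.1 * p.2⁻¹ = x)).card : ℤ)
      = if x ∈ D then -m + r ^ 2 + 3 * r else r ^ 2 + r) : False := by
  obtain ⟨j, rfl⟩ := Nat.exists_eq_add_of_le' (show 1 ≤ n by omega)
  set u : ℕ := 2 ^ j + 1 with hu
  have hj : 1 ≤ j := by omega
  have hα' : α = 2 * (u : ℤ) - 1 := by rw [hα, hu]; push_cast; ring
  have hm' : m = 8 * ((u : ℤ) - 1) * u ^ 2 := by rw [hm, hα']; ring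
  have hr' : r = 4 * ((u : ℤ) - 1) * u := by rw [hr, hα']; ring
  have hu3 : 3 ≤ u := by
    have := Nat.pow_le_pow_right (n := 2) (by norm_num) hj
    omega
  have hodd : Odd u := (even_two.pow_of_ne_zero (by omega)).add_one
  have hGcard : Nat.card G = 2 ^ (2 * j + 6) * u ^ 4 := by
    rw [Nat.card_eq_fintype_card]
    zify
    rw [hG, hm']
    have : (u : ℤ) - 1 = 2 ^ j := by rw [hu]; push_cast; ring
    rw [this]
    ring
  have hcop : (2 ^ (2 * j + 6)).Coprime u := (Nat.coprime_two_left.2 hodd).pow_left _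
  obtain ⟨S, hS⟩ := Sylow.exists_subgroup_card_pow_prime (G := G) 2 (n := 2 * j + 6)
    (by rw [hGcard]; exact dvd_mul_right _ _)
  have hSi : S.index = u ^ 4 := by
    have := S.card_mul_index
    rw [hS, hGcard] at this
    exact Nat.eq_of_mul_eq_mul_left (by positivity) this
  -- By Schur–Zassenhaus the Sylow 2-subgroup `S` has a complement `H`, of order `u⁴`, and `G ⧸ H`
  -- has the order of `S`.
  obtain ⟨H, hH⟩ := Subgroup.exists_right_complement'_of_coprime (N := S)
    (by rw [hS, hSi]; exact hcop.pow_right 4)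
  classical
  have hQ : Fintype.card (G ⧸ H) = 2 ^ (2 * j + 6) := by
    rw [← Nat.card_eq_fintype_card, ← hS, ← hH.index_eq_card]
    rfl
  have hlμ : -m + r ^ 2 + 3 * r ≠ r ^ 2 + r := by
    have h3 : (3 : ℤ) ≤ u := by exact_mod_cast hu3
    intro h
    have h0 : 8 * (((u : ℤ) - 1) * u) * (u - 1) = 0 := by
      rw [hm', hr'] at h
      linear_combination -h
    have : 0 < 8 * (((u : ℤ) - 1) * u) * (u - 1) := by
      have : 0 < (u : ℤ) - 1 := by omega
      positivity
    omega
  obtain ⟨hinv, hD⟩ := groupRing_mul_self_of_card_rep hk hrep hlμ (by rw [hG]; ring)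
  refine not_exists_groupRing_of_quotient (QuotientGroup.mk' H) (QuotientGroup.mk'_surjective H)
    u hu3 hodd ?_ (hQ ▸ hcop) ?_ hr' hm' hk hinv ?_
  · rw [hQ, hu]
    push_cast
    ring
  · rw [hQ, ← Nat.card_eq_fintype_card, hGcard]
  · rw [hD]
    congr 4
    ring

theorem not_isPartialDifferenceSet {G : Type*} [CommGroup G] {n : ℕ} (hn : 2 ≤ n) {α m r : ℤ}
    (hα : α = 2 ^ n + 1) (hm : m = (α + 1) ^ 2 * (α - 1)) (hr : r = α ^ 2 - 1) (D : Set G) :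
    ¬ IsPartialDifferenceSet D (m ^ 2) (r * (m + 1)) (-m + r ^ 2 + 3 * r) (r ^ 2 + r) := by
  classical
  intro h
  have := h.finite
  have := Fintype.ofFinite G
  have hset : ∀ x ≠ 1, {p : G × G | p.1 ∈ D ∧ p.2 ∈ D ∧ p.1 ≠ p.2 ∧ p.1 * p.2⁻¹ = x} =
      ((D.toFinset ×ˢ D.toFinset).filter (fun p => p.1 * p.2⁻¹ = x) : Finset (G × G)) := by
    intro x hx
    ext ⟨a, b⟩
    simp only [Set.mem_ofPred_eq, Finset.coe_filter, Finset.mem_product, Set.mem_toFinset]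
    refine ⟨fun h => ⟨⟨h.1, h.2.1⟩, h.2.2.2⟩, fun h => ⟨h.1.1, h.1.2, ?_, h.2⟩⟩
    rintro rfl
    exact hx (by rw [← h.2, mul_inv_cancel])
  refine not_partialDifferenceSet_of_card hn hα hm hr D.toFinset ?_ ?_ ?_
  · rw [← Nat.card_eq_fintype_card, h.card_group]
  · rw [← h.card_set, Set.ncard_eq_toFinset_card']
  · intro x hx
    rw [← Set.ncard_coe_finset, ← hset x hx]
    split_ifs with hxD
    · exact h.rep_mem x (by simpa using hxD) hx
    · exact h.rep_not_mem x (by simpa using hxD) hx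
-- Collinearity counts in a partial geometry
section
open scoped Classical

namespace IsProperPartialGeometry
variable {P L : Type*} {Inc : P → L → Prop} {s t α : ℤ}

theorem line_unique (h : IsProperPartialGeometry Inc s t α) {x y : P} (hxy : x ≠ y) {l l' : L}
    (hx : Inc x l) (hy : Inc y l) (hx' : Inc x l') (hy' : Inc y l') : l = l' := by
  by_contra hne
  exact hxy (h.inter l l' hne ⟨hx, hx'⟩ ⟨hy, hy'⟩)

theorem card_points_filter [Fintype P] (h : IsProperPartialGeometry Inc s t α) (l : L) :
    ((Finset.univ.filter (fun x => Inc x l)).card : ℤ) = s + 1 := by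
  rw [← h.card_points l, Set.ncard_eq_toFinset_card', Set.toFinset_ofPred]

theorem card_lines_filter [Fintype L] (h : IsProperPartialGeometry Inc s t α) (x : P) :
    ((Finset.univ.filter (fun l => Inc x l)).card : ℤ) = t + 1 := by
  rw [← h.card_lines x, Set.ncard_eq_toFinset_card', Set.toFinset_ofPred]

variable [Fintype P] [Fintype L]

/-- Points collinear with `x` are counted line by line. -/
theorem card_collinear_eq_sum (h : IsProperPartialGeometry Inc s t α) (x : P) (R : P → Prop)
    [DecidablePred R] :
    (Finset.univ.filter (fun z => z ≠ x ∧ (∃ l, Inc x l ∧ Inc z l) ∧ R z)).card =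
      ∑ l ∈ Finset.univ.filter (fun l => Inc x l),
        (Finset.univ.filter (fun z => z ≠ x ∧ Inc z l ∧ R z)).card := by
  rw [← Finset.card_biUnion]
  · congr 1
    ext z
    simp only [Finset.mem_filter, Finset.mem_univ, true_and, Finset.mem_biUnion]
    tauto
  · intro l hl l' hl' hne
    rw [Function.onFun, Finset.disjoint_left]
    intro z hz hz'
    simp only [Finset.coe_filter, Set.mem_ofPred_eq, Finset.mem_filter, Finset.mem_univ,
      true_and] at hl hl' hz hz'
    exact hne (h.line_unique hz.1 hz.2.1 hl hz'.2.1 hl')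

theorem card_collinear (h : IsProperPartialGeometry Inc s t α) (x : P) :
    ((Finset.univ.filter (fun z => z ≠ x ∧ ∃ l, Inc x l ∧ Inc z l)).card : ℤ) = (t + 1) * s := by
  have := h.card_collinear_eq_sum x (fun _ => True)
  simp only [and_true] at this
  rw [this, Nat.cast_sum, Finset.sum_congr rfl (g := fun _ => s), Finset.sum_const, nsmul_eq_mul,
    h.card_lines_filter]
  intro l hl
  have hx : x ∈ Finset.univ.filter (fun z => Inc z l) := by simpa using hl
  have h1 := Finset.card_erase_add_one hx
  have h2 := h.card_points_filter l
  have h3 : (Finset.univ.filter (fun z => z ≠ x ∧ Inc z l)) =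
      (Finset.univ.filter (fun z => Inc z l)).erase x := by
    ext z; simp
  rw [h3]
  omega

/-- If `y` is not on `l`, exactly `α` points on `l` are collinear with `y`. -/
theorem card_points_collinear (h : IsProperPartialGeometry Inc s t α) {y : P} {l : L}
    (hy : ¬ Inc y l) :
    ((Finset.univ.filter (fun z => Inc z l ∧ ∃ l', Inc y l' ∧ Inc z l')).card : ℤ) = α := by
  rw [← h.card_meet y l hy, Set.ncard_eq_toFinset_card', Set.toFinset_ofPred, Nat.cast_inj]
  have hex : ∀ z ∈ Finset.univ.filter (fun z => Inc z l ∧ ∃ l', Inc y l' ∧ Inc z l'),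
      ∃ l', Inc y l' ∧ Inc z l' := fun z hz => (Finset.mem_filter.1 hz).2.2
  have : Nonempty L := ⟨l⟩
  choose! f hf using hex
  refine Finset.card_nbij f ?_ ?_ ?_
  · intro z hz
    have h1 := hf z hz
    simp only [Finset.coe_filter, Finset.mem_univ, true_and,
      Set.mem_ofPred_eq] at hz ⊢
    exact ⟨h1.1, z, h1.2, hz.1⟩
  · intro z hz z' hz' he
    have h1 := hf z hz
    have h2 := hf z' hz'
    rw [← he] at h2
    simp only [Finset.coe_filter, Finset.mem_univ, true_and, Set.mem_ofPred_eq] at hz hz'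
    by_contra hne
    have := h.line_unique hne hz.1 hz'.1 h1.2 h2.2
    exact hy (this ▸ h1.1)
  · intro l' hl'
    simp only [Finset.coe_filter, Finset.mem_univ, true_and, Set.mem_ofPred_eq] at hl'
    obtain ⟨hyl', z, hzl', hzl⟩ := hl'
    have hz : z ∈ Finset.univ.filter (fun z => Inc z l ∧ ∃ l', Inc y l' ∧ Inc z l') := by
      simp only [Finset.mem_filter, Finset.mem_univ, true_and]
      exact ⟨hzl, l', hyl', hzl'⟩
    refine ⟨z, hz, ?_⟩
    have hne : z ≠ y := by rintro rfl; exact hy hzl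
    exact h.line_unique hne (hf z hz).2 (hf z hz).1 hzl' hyl'

theorem card_common_of_not_collinear (h : IsProperPartialGeometry Inc s t α) {x y : P}
    (hxy : ¬ ∃ l, Inc x l ∧ Inc y l) :
    ((Finset.univ.filter (fun z => z ≠ x ∧ (∃ l, Inc x l ∧ Inc z l) ∧
      z ≠ y ∧ ∃ l, Inc y l ∧ Inc z l)).card : ℤ) = α * (t + 1) := by
  rw [h.card_collinear_eq_sum x, Nat.cast_sum, Finset.sum_congr rfl (g := fun _ => α),
    Finset.sum_const, nsmul_eq_mul, h.card_lines_filter, mul_comm]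
  intro l hl
  have hxl : Inc x l := by simpa using hl
  have hyl : ¬ Inc y l := fun hyl => hxy ⟨l, hxl, hyl⟩
  rw [← h.card_points_collinear hyl]
  congr 2
  ext z
  simp only [Finset.mem_filter, Finset.mem_univ, true_and]
  constructor
  · tauto
  · rintro ⟨hz, l', hy', hz'⟩
    refine ⟨?_, hz, ?_, l', hy', hz'⟩
    · rintro rfl; exact hxy ⟨l', hz', hy'⟩
    · rintro rfl; exact hyl hz

theorem card_common_of_collinear (h : IsProperPartialGeometry Inc s t α) {x y : P} (hne : x ≠ y)
    (hxy : ∃ l, Inc x l ∧ Inc y l) :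
    ((Finset.univ.filter (fun z => z ≠ x ∧ (∃ l, Inc x l ∧ Inc z l) ∧
      z ≠ y ∧ ∃ l, Inc y l ∧ Inc z l)).card : ℤ) = s - 1 + t * (α - 1) := by
  obtain ⟨l₀, hx₀, hy₀⟩ := hxy
  -- The line `l₀` joining `x` and `y` contributes `s - 1`; any other line through `x` has `α`
  -- points collinear with `y`, one of them `x` itself.
  rw [h.card_collinear_eq_sum x, Nat.cast_sum, Finset.sum_congr rfl
    (g := fun l => (α - 1) + if l = l₀ then s - α else 0), Finset.sum_add_distrib,
    Finset.sum_const, nsmul_eq_mul, h.card_lines_filter, Finset.sum_ite_eq', if_pos (by simpa)]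
  · ring
  intro l hl
  have hxl : Inc x l := by simpa using hl
  split_ifs with hll
  · subst hll
    have h1 : y ∈ Finset.univ.filter (fun z => Inc z l) := by simpa using hy₀
    have h2 : x ∈ (Finset.univ.filter (fun z => Inc z l)).erase y := by simpa [hne] using hx₀
    have h3 := Finset.card_erase_add_one h1
    have h4 := Finset.card_erase_add_one h2
    have h5 := h.card_points_filter l
    have h6 : (Finset.univ.filter (fun z => z ≠ x ∧ Inc z l ∧ z ≠ y ∧ ∃ l, Inc y l ∧ Inc z l)) =
        ((Finset.univ.filter (fun z => Inc z l)).erase y).erase x := by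
      ext z
      simp only [Finset.mem_filter, Finset.mem_univ, true_and, Finset.mem_erase]
      constructor
      · tauto
      · rintro ⟨h1, h2, h3⟩
        exact ⟨h1, h3, h2, l, hy₀, h3⟩
    rw [h6]
    omega
  · have hyl : ¬ Inc y l := fun hyl => hll (h.line_unique hne hxl hyl hx₀ hy₀)
    have h1 : x ∈ Finset.univ.filter (fun z => Inc z l ∧ ∃ l', Inc y l' ∧ Inc z l') := by
      simp only [Finset.mem_filter, Finset.mem_univ, true_and]
      exact ⟨hxl, l₀, hy₀, hx₀⟩
    have h2 := Finset.card_erase_add_one h1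
    have h3 := h.card_points_collinear hyl
    have h4 : (Finset.univ.filter (fun z => z ≠ x ∧ Inc z l ∧ z ≠ y ∧ ∃ l, Inc y l ∧ Inc z l)) =
        (Finset.univ.filter (fun z => Inc z l ∧ ∃ l', Inc y l' ∧ Inc z l')).erase x := by
      ext z
      simp only [Finset.mem_filter, Finset.mem_univ, true_and, Finset.mem_erase]
      constructor
      · tauto
      · rintro ⟨hzx, hzl, hzy⟩
        refine ⟨hzx, hzl, ?_, hzy⟩
        rintro rfl; exact hyl hzl
    rw [h4]
    omega

end IsProperPartialGeometry
end
-- From Singer groups to partial difference sets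
section
open scoped Classical

namespace IsSingerGroup
variable {G P L : Type*} [Group G] [MulAction G P] [MulAction G L] {Inc : P → L → Prop}

theorem exists_inc_smul_iff (h : IsSingerGroup G Inc) (g : G) (x y : P) :
    (∃ l, Inc (g • x) l ∧ Inc (g • y) l) ↔ ∃ l, Inc x l ∧ Inc y l := by
  constructor
  · rintro ⟨l, hx, hy⟩
    rw [← smul_inv_smul g l, h.inc_smul_iff] at hx hy
    exact ⟨_, hx, hy⟩
  · rintro ⟨l, hx, hy⟩
    exact ⟨g • l, (h.inc_smul_iff g x l).2 hx, (h.inc_smul_iff g y l).2 hy⟩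

theorem bijective_smul (h : IsSingerGroup G Inc) (x : P) :
    Function.Bijective (fun g : G => g • x) :=
  Function.bijective_iff_existsUnique _ |>.2 fun y => h.sharply_transitive x y

theorem card_filter_smul (h : IsSingerGroup G Inc) [Fintype G] [Fintype P] (x : P) (R : P → Prop)
    [DecidablePred R] :
    (Finset.univ.filter (fun g : G => R (g • x))).card = (Finset.univ.filter R).card :=
  Finset.card_bijective _ (h.bijective_smul x) (by simp)

theorem smul_eq_self_iff (h : IsSingerGroup G Inc) (g : G) (x : P) : g • x = x ↔ g = 1 := by
  rw [← (h.bijective_smul x).injective.eq_iff (a := g)]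
  simp

end IsSingerGroup

/-- The elements of an abelian Singer group that move a base point to a collinear point form a
partial difference set. -/
theorem IsProperPartialGeometry.card_filter_mul_inv_eq {G P L : Type*} [CommGroup G] [Fintype G]
    [MulAction G P] [MulAction G L] {Inc : P → L → Prop} {s t α : ℤ} [Fintype P] [Fintype L]
    (h : IsProperPartialGeometry Inc s t α) (hS : IsSingerGroup G Inc) (x₀ : P) {D : Finset G}
    (hD : D = Finset.univ.filter
      (fun g : G => g • x₀ ≠ x₀ ∧ ∃ l, Inc x₀ l ∧ Inc (g • x₀) l)) :
    (D.card : ℤ) = (t + 1) * s ∧ ∀ x ≠ 1,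
      (((D ×ˢ D).filter (fun p => p.1 * p.2⁻¹ = x)).card : ℤ)
        = if x ∈ D then s - 1 + t * (α - 1) else α * (t + 1) := by
  constructor
  · rw [← h.card_collinear x₀, hD, Nat.cast_inj]
    exact hS.card_filter_smul x₀ (fun z => z ≠ x₀ ∧ ∃ l, Inc x₀ l ∧ Inc z l)
  intro x hx
  set y : P := x⁻¹ • x₀ with hy
  have hyx : x • y = x₀ := by rw [hy, smul_inv_smul]
  have hne : x₀ ≠ y := by
    intro he
    exact hx (by rw [← inv_eq_one, ← hS.smul_eq_self_iff x⁻¹ x₀]; exact he.symm)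
  have hcount : ((D ×ˢ D).filter (fun p => p.1 * p.2⁻¹ = x)).card =
      (Finset.univ.filter (fun z => z ≠ x₀ ∧ (∃ l, Inc x₀ l ∧ Inc z l) ∧
      z ≠ y ∧ ∃ l, Inc y l ∧ Inc z l)).card := by
    rw [← hS.card_filter_smul x₀]
    -- A pair is determined by its second entry `g`. Translating by `x⁻¹` turns "`(x * g) • x₀` is
    -- collinear with `x₀`" into "`g • x₀` is collinear with `y`".
    refine Finset.card_nbij' (fun p => p.2) (fun g => (x * g, g)) ?_ ?_ ?_ ?_
    · rintro ⟨a, b⟩ hp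
      simp only [Finset.coe_filter, Finset.mem_product, Set.mem_ofPred_eq, Finset.mem_univ,
        true_and, hD, Finset.mem_filter] at hp ⊢
      obtain ⟨⟨⟨ha1, ha2⟩, hb1, hb2⟩, hab⟩ := hp
      obtain rfl : a = x * b := by rw [← hab]; group
      refine ⟨hb1, hb2, ?_, ?_⟩
      · intro he
        exact ha1 (by rw [mul_smul, he, hyx])
      · rw [← hS.exists_inc_smul_iff x, hyx, ← mul_smul]
        exact ha2
    · intro g hg
      simp only [Finset.coe_filter, Finset.mem_product, Set.mem_ofPred_eq, Finset.mem_univ,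
        true_and, hD, Finset.mem_filter] at hg ⊢
      obtain ⟨hg1, hg2, hg3, hg4⟩ := hg
      refine ⟨⟨⟨?_, ?_⟩, hg1, hg2⟩, by group⟩
      · intro he
        exact hg3 (by rw [hy, eq_inv_smul_iff, ← mul_smul, he])
      · rw [← hS.exists_inc_smul_iff x, hyx, ← mul_smul] at hg4
        exact hg4
    · rintro ⟨a, b⟩ hp
      have := (Finset.mem_filter.1 hp).2
      simp [← this]
    · intro g _; rfl
  have hxD : x ∈ D ↔ ∃ l, Inc x₀ l ∧ Inc y l := by
    rw [← hS.exists_inc_smul_iff x, hyx, hD, Finset.mem_filter]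
    simp only [Finset.mem_univ, true_and, ne_eq, hS.smul_eq_self_iff, hx, not_false_iff]
    exact exists_congr fun l => and_comm
  rw [hcount]
  split_ifs with hc
  · exact h.card_common_of_collinear hne (hxD.1 hc)
  · exact h.card_common_of_not_collinear (fun hl => hc (hxD.2 hl))

theorem not_isSingerGroup {G P L : Type*} [CommGroup G] [MulAction G P] [MulAction G L] {n : ℕ}
    (hn : 2 ≤ n) {α : ℤ} (hα : α = 2 ^ n + 1) {Inc : P → L → Prop}
    (h : IsProperPartialGeometry Inc (α ^ 2 + α - 1) (α ^ 3 - α - 1) α) :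
    ¬ IsSingerGroup G Inc := by
  intro hS
  have := h.finite_points
  have := h.finite_lines
  have := Fintype.ofFinite P
  have := Fintype.ofFinite L
  obtain ⟨x₀⟩ := h.nonempty_points
  have : Finite G := Finite.of_injective _ (hS.bijective_smul x₀).injective
  have := Fintype.ofFinite G
  obtain ⟨D, hD⟩ : ∃ D : Finset G, D = Finset.univ.filter
      (fun g : G => g • x₀ ≠ x₀ ∧ ∃ l, Inc x₀ l ∧ Inc (g • x₀) l) := ⟨_, rfl⟩
  obtain ⟨hk, hrep⟩ := h.card_filter_mul_inv_eq hS x₀ hD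
  have h1D : (1 : G) ∉ D := by simp [hD]
  have hα2 : 2 ≤ α := by
    have : (1 : ℤ) ≤ 2 ^ n := one_le_pow₀ (by norm_num)
    omega
  -- The order of `G` comes from counting all pairs in `D ×ˢ D` by their quotient and cancelling `α
  -- * (t + 1)`.
  have hG : (Fintype.card G : ℤ) = ((α + 1) ^ 2 * (α - 1)) ^ 2 := by
    have hsum : ∑ x, (((D ×ˢ D).filter (fun p => p.1 * p.2⁻¹ = x)).card : ℤ) = D.card ^ 2 := by
      exact_mod_cast D.sum_card_filter_mul_inv_eq
    set s := α ^ 2 + α - 1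
    set t := α ^ 3 - α - 1
    have hN : ∀ x, (((D ×ˢ D).filter (fun p => p.1 * p.2⁻¹ = x)).card : ℤ) =
        α * (t + 1) + (if x ∈ D then s - 1 + t * (α - 1) - α * (t + 1) else 0)
        + (if x = 1 then (t + 1) * s - α * (t + 1) else 0) := by
      intro x
      by_cases hx : x = 1
      · subst hx
        rw [D.card_filter_mul_inv_eq_one, hk, if_pos rfl, if_neg h1D]
        ring
      · rw [hrep x hx, if_neg hx]
        split_ifs <;> ring
    simp only [hN] at hsum
    rw [Finset.sum_add_distrib, Finset.sum_add_distrib, Finset.sum_ite_mem, Finset.univ_inter,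
      Finset.sum_const, Finset.sum_const, Finset.sum_ite_eq', if_pos (Finset.mem_univ _),
      nsmul_eq_mul, nsmul_eq_mul, hk, Finset.card_univ] at hsum
    have hpos : α * (t + 1) ≠ 0 := by
      have : α * (t + 1) = α ^ 2 * (α + 1) * (α - 1) := by ring
      rw [this]
      have : 0 < α - 1 := by omega
      positivity
    apply mul_right_cancel₀ hpos
    linear_combination hsum
  refine not_partialDifferenceSet_of_card hn hα rfl rfl D hG ?_ ?_
  · rw [hk]; ring
  · intro x hx
    rw [hrep x hx]
    congr 1 <;> ring
end

theorem mainTheorem2 (n : ℕ) (hn : 2 ≤ n) (α m r : ℤ) (hα : α = 2 ^ n + 1)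
    (hm : m = (α + 1) ^ 2 * (α - 1)) (hr : r = α ^ 2 - 1) :
    (∀ (G : Type*) [CommGroup G],
      ¬ ∃ D : Set G,
        IsPartialDifferenceSet D (m ^ 2) (r * (m + 1)) (-m + r ^ 2 + 3 * r) (r ^ 2 + r)) ∧
    (∀ (G P L : Type*) [CommGroup G] [MulAction G P] [MulAction G L],
      ¬ ∃ Inc : P → L → Prop,
        IsProperPartialGeometry Inc (α ^ 2 + α - 1) (α ^ 3 - α - 1) α ∧
          IsSingerGroup G Inc ∧ IsRigidType G L) := by
  refine ⟨?_, ?_⟩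
  · rintro G _ ⟨D, hD⟩
    exact not_isPartialDifferenceSet hn hα hm hr D hD
  · rintro G P L _ _ _ ⟨Inc, h, hS, -⟩
    exact not_isSingerGroup hn hα h hS
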